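/- Let $G$ be a finite graph. For a positive integer $s$, let $\alpha_s(G)$ be the maximum number of vertices in a $K_s$-free induced subgraph of $G$. For a graph $H$ and a real number $f$, let $\mathbf{RT}_s(n,H,f)$ be the maximum number of edges in an $H$-free graph $G$ on $n$ vertices with $\alpha_s(G)<f$, and put $\mathbf{RT}_s(n,H,f)=0$ if there is no such graph. **Theorem.** Let $r\ge 1$ be an integer, let $\varepsilon>0$, and let $\frac12+\frac1{2(2r+1)}<\delta<1$. Then there is an $s_0$ (which may depend on $r$, $\varepsilon$, $\delta$) such that for every integer $s\ge s_0$, $$\mathbf{RT}_s(n,K_{s+r},n^\delta)=\Omega\!\left(n^{2-(1-\delta)/r-\varepsilon}\right)\qquad (n\to\infty),$$ that is, there are $c>0$ and $n_0$ (which may depend on $s$, $r$, $\varepsilon$, $\delta$) such that $\mathbf{RT}_s(n,K_{s+r},n^\delta)\ge c\,n^{2-(1-\delta)/r-\varepsilon}$ for all $n\ge n_0$. -/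

import Mathlib

namespace RamseyTuran

/-- The `s`-independence number `α_s(G)`: the maximum number of vertices in a `K_s`-free
induced subgraph of `G`. -/
noncomputable def sIndepNum {V : Type*} [Fintype V] (G : SimpleGraph V) (s : ℕ) : ℕ :=
  sSup {m : ℕ | ∃ U : Finset V, (G.induce (U : Set V)).CliqueFree s ∧ U.card = m}

/-- The Ramsey–Turán number `RT_s(n, H, f)`: the maximum number of edges of an `H`-free graph `G`
on `n` vertices with `α_s(G) < f`. It is `0` when there is no such graph, as the supremum in `ℕ`
of the empty set is `0`. The set is bounded, there being finitely many graphs on `Fin n`. -/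
noncomputable def ramseyTuranNum (s n : ℕ) {W : Type*} (H : SimpleGraph W) (f : ℝ) : ℕ :=
  sSup {m : ℕ | ∃ G : SimpleGraph (Fin n),
    H.Free G ∧ (sIndepNum G s : ℝ) < f ∧ G.edgeSet.ncard = m}

end RamseyTuran

namespace AffineColoring

open Finset
open scoped Classical

/-! ### Union bounds by counting colourings -/

section Counting

variable {α β ι : Type*} [Fintype α] [DecidableEq α] [Fintype β]

/-! Take a prime `q` of order `n ^ γ` and spread the `n` vertices over the `q ^ 2` points of the
affine plane over `ZMod q`, at most `B ≈ n / q ^ 2` on each point. Every flag (a non-vertical line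
with a point on it) independently receives a uniform colour in `Fin K × Fin s`, so it is active with
probability `1 / K`, where `K ≈ q ^ τ`. On each line the active vertices span a complete
multipartite graph with at most `s` parts.

Cliques (`exists_flags_of_isClique`): a line contains at most `s` vertices of a clique. Hence a
clique of size `s + r` contains either `v` points in general position, or `h` points on a line
together with `r` points off it. These force `v * (v - 1)`, respectively `h + 2 * r * h`, distinct
flags to be active, against at most `q ^ (2 * v)`, respectively `q ^ (2 + h + 2 * r)`,
configurations. Since `τ > 1 / (2 * r + 1)`, large `h` and `v` make both unlikely.

Independence (`card_filter_exists_not_isRainbowOn_mul_le`): with high probability every set of `M =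
4 * q * K * s * s` points has a line showing all `s` colours, hence a `K_s`. So `α_s < M * B`, of
order `n ^ (1 - γ * (1 - τ))` and below `n ^ δ`.

Edges: a pair of vertices with distinct abscissae is adjacent with probability at least `1 / (K * s)
^ 2`, so the expected number is of order `n ^ (2 - 2 * γ * τ)`. As `τ` tends to `1 / (2 * r + 1)`
with `γ * (1 - τ)` tending to `1 - δ`, the loss `2 * γ * τ` tends to `(1 - δ) / r`.
`exists_flagColoring` combines the three estimates. -/

theorem card_filter_forall_mem_mul (I : Finset α) (P : α → Finset β) (k : ℕ)
    (hP : ∀ a ∈ I, (P a).card = k) :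
    (univ.filter fun c : α → β => ∀ a ∈ I, c a ∈ P a).card * Fintype.card β ^ I.card =
      k ^ I.card * Fintype.card (α → β) := by
  have h : (univ.filter fun c : α → β => ∀ a ∈ I, c a ∈ P a) =
      Fintype.piFinset fun a => if a ∈ I then P a else univ := by
    ext c
    simp only [mem_filter, mem_univ, true_and, Fintype.mem_piFinset]
    refine forall_congr' fun a => ?_
    by_cases ha : a ∈ I <;> simp [ha]
  have h1 : ∏ a : α, (if a ∈ I then P a else univ).card =
      k ^ I.card * Fintype.card β ^ Iᶜ.card := by
    rw [← prod_mul_prod_compl I]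
    congr 1
    · rw [← prod_const]
      exact prod_congr rfl fun a ha => by simp [ha, hP a ha]
    · rw [← prod_const]
      exact prod_congr rfl fun a ha => by simp [mem_compl.1 ha]
  rw [h, Fintype.card_piFinset, h1, mul_assoc, ← pow_add, Fintype.card_fun,
    card_compl_add_card]

/-- Union bound over `D` for a uniform random `c`, each event having probability `(k / card β) ^ m`;
denominators are cleared to stay in `ℕ`. -/
theorem card_filter_exists_forall_mem_mul_le (D : Finset ι) (I : ι → Finset α)
    (P : ι → α → Finset β) (m k : ℕ) (hI : ∀ d ∈ D, (I d).card = m)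
    (hP : ∀ d ∈ D, ∀ a ∈ I d, (P d a).card = k) :
    (univ.filter fun c : α → β => ∃ d ∈ D, ∀ a ∈ I d, c a ∈ P d a).card *
      Fintype.card β ^ m ≤ D.card * k ^ m * Fintype.card (α → β) := by
  have h : (univ.filter fun c : α → β => ∃ d ∈ D, ∀ a ∈ I d, c a ∈ P d a) ⊆
      D.biUnion fun d => univ.filter fun c : α → β => ∀ a ∈ I d, c a ∈ P d a := by
    intro c hc
    simpa using hc
  calc _ ≤ (∑ d ∈ D, (univ.filter fun c : α → β => ∀ a ∈ I d, c a ∈ P d a).card) *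
          Fintype.card β ^ m := by
        gcongr
        exact (card_le_card h).trans card_biUnion_le
    _ = ∑ d ∈ D, k ^ m * Fintype.card (α → β) := by
        rw [sum_mul]
        refine sum_congr rfl fun d hd => ?_
        have := card_filter_forall_mem_mul (I d) (P d) k (hP d hd)
        rwa [hI d hd] at this
    _ = _ := by rw [sum_const, smul_eq_mul, mul_assoc]

end Counting

/-! ### Non-vertical lines of the affine plane -/

section Plane

variable {F : Type*} [Field F]

/-- The point `p` lies on the non-vertical line `y = l.1 * x + l.2`. -/
def On (l p : F × F) : Prop := p.2 = l.1 * p.1 + l.2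

/-- The non-vertical line through two points with distinct abscissae. -/
noncomputable def lineThrough (p q : F × F) : F × F :=
  ((p.2 - q.2) / (p.1 - q.1), p.2 - (p.2 - q.2) / (p.1 - q.1) * p.1)

theorem on_lineThrough_left (p q : F × F) : On (lineThrough p q) p := by
  simp [On, lineThrough]

theorem on_lineThrough_right {p q : F × F} (h : p.1 ≠ q.1) : On (lineThrough p q) q := by
  have : p.1 - q.1 ≠ 0 := sub_ne_zero.2 h
  simp only [On, lineThrough]
  field_simp
  ring

theorem On.eq_lineThrough {l p q : F × F} (hp : On l p) (hq : On l q) (h : p.1 ≠ q.1) :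
    l = lineThrough p q := by
  have h' : p.1 - q.1 ≠ 0 := sub_ne_zero.2 h
  simp only [On] at hp hq
  have h1 : l.1 = (p.2 - q.2) / (p.1 - q.1) := by
    rw [eq_div_iff h', hp, hq]
    ring
  refine Prod.ext h1 ?_
  simp only [lineThrough]
  rw [← h1, hp]
  ring

theorem On.line_eq {l l' p q : F × F} (hp : On l p) (hq : On l q) (hp' : On l' p)
    (hq' : On l' q) (h : p.1 ≠ q.1) : l = l' :=
  (hp.eq_lineThrough hq h).trans (hp'.eq_lineThrough hq' h).symm

end Plane

/-! ### The graph of a flag colouring -/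

section Graph

variable {F V : Type*} [Field F] {K s : ℕ} [NeZero K]

/-- A colouring of the flags of the plane: the flag consisting of the line `l` and its point
with abscissa `x` receives the colour `c (l, x)`. The flag is active when the first component
is `0`. -/
abbrev FlagColoring (F : Type*) (K s : ℕ) : Type _ := (F × F) × F → Fin K × Fin s

/-- Two vertices, placed at points of the plane by `f`, are adjacent when they lie on a common
line on which both are active and have distinct colours. -/
def flagGraph (f : V → F × F) (c : FlagColoring F K s) : SimpleGraph V where
  Adj u w := ∃ l, On l (f u) ∧ On l (f w) ∧ (c (l, (f u).1)).1 = 0 ∧ (c (l, (f w).1)).1 = 0 ∧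
    (c (l, (f u).1)).2 ≠ (c (l, (f w).1)).2
  symm := ⟨fun _ _ ⟨l, h1, h2, h3, h4, h5⟩ => ⟨l, h2, h1, h4, h3, h5.symm⟩⟩
  loopless := ⟨fun _ ⟨_, _, _, _, _, h⟩ => h rfl⟩

variable {f : V → F × F} {c : FlagColoring F K s}

theorem flagGraph_adj_fst_ne {u w : V} (h : (flagGraph f c).Adj u w) : (f u).1 ≠ (f w).1 := by
  obtain ⟨l, -, -, -, -, h⟩ := h
  intro h'
  rw [h'] at h
  exact h rfl

theorem flagGraph_adj_of_on {u w : V} (h : (flagGraph f c).Adj u w) {l : F × F}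
    (hu : On l (f u)) (hw : On l (f w)) :
    (c (l, (f u).1)).1 = 0 ∧ (c (l, (f w).1)).1 = 0 ∧
      (c (l, (f u).1)).2 ≠ (c (l, (f w).1)).2 := by
  have hne := flagGraph_adj_fst_ne h
  obtain ⟨l', h1, h2, h3⟩ := h
  obtain rfl := hu.line_eq hw h1 h2 hne
  exact h3

/-- Clique vertices on one line have distinct colours in `Fin s`. This is what leaves `r` vertices
of an `(s + r)`-clique off any given line. -/
theorem card_on_le_of_isClique {W : Finset V} (hW : (flagGraph f c).IsClique (W : Set V))
    (l : F × F) : (W.filter fun w => On l (f w)).card ≤ s := by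
  have := Finset.card_le_card_of_injOn (s := W.filter fun w => On l (f w))
    (t := (univ : Finset (Fin s))) (fun w => (c (l, (f w).1)).2) (by simp) ?_
  · simpa using this
  · intro u hu w hw huw
    rw [mem_coe, mem_filter] at hu hw
    by_contra hne
    exact (flagGraph_adj_of_on (hW hu.1 hw.1 hne) hu.2 hw.2).2.2 huw

end Graph

/-! ### Flag configurations forced by a large clique -/

section Configurations

variable {F : Type*} [Field F]

/-- The flags spanned by the ordered pairs of a family of points. -/
noncomputable def pairFlags {v : ℕ} (d : Fin v → F × F) :
    {p : Fin v × Fin v // p.1 ≠ p.2} → (F × F) × F :=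
  fun p => (lineThrough (d p.1.1) (d p.1.2), (d p.1.1).1)

/-- The point of a line with given abscissa. -/
def linePoint (l : F × F) (x : F) : F × F := (x, l.1 * x + l.2)

theorem on_linePoint (l : F × F) (x : F) : On l (linePoint l x) := rfl

theorem On.linePoint_eq {l p : F × F} (h : On l p) : linePoint l p.1 = p :=
  Prod.ext rfl h.symm

/-- The flags spanned by a line `d.1`, the points on it with abscissae `d.2.1`, and the
points `d.2.2` outside it. -/
noncomputable def lineFlags {h r : ℕ} (d : (F × F) × (Fin h → F) × (Fin r → F × F)) :
    Fin h ⊕ (Fin r × Fin h) ⊕ (Fin r × Fin h) → (F × F) × F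
  | .inl k => (d.1, d.2.1 k)
  | .inr (.inl p) => (lineThrough (d.2.2 p.1) (linePoint d.1 (d.2.1 p.2)), (d.2.2 p.1).1)
  | .inr (.inr p) => (lineThrough (d.2.2 p.1) (linePoint d.1 (d.2.1 p.2)), d.2.1 p.2)

theorem pairFlags_injective {v : ℕ} {d : Fin v → F × F}
    (hx : Function.Injective fun i => (d i).1)
    (hd : ∀ i j k, i ≠ j → k ≠ i → k ≠ j → ¬ On (lineThrough (d i) (d j)) (d k)) :
    Function.Injective (pairFlags d) := by
  rintro ⟨⟨i, j⟩, hij⟩ ⟨⟨i', j'⟩, hij'⟩ h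
  simp only [pairFlags, Prod.mk.injEq] at h
  obtain ⟨h1, h2⟩ := h
  obtain rfl : i = i' := hx h2
  simp only [ne_eq] at hij hij'
  have : j = j' := by
    by_contra hne
    refine hd i j' j hij' (Ne.symm hij) hne ?_
    rw [← h1]
    exact on_lineThrough_right fun h => hij (hx h)
  subst this
  rfl

/-- A line joining `X i` to a point of `l` differs from `l`, so it determines that point; if it also
passed through `X j`, the point would lie on the line through `X i` and `X j`. Distinctness of the
flags is what makes their colours independent. -/
theorem lineFlags_injective {h r : ℕ} {l : F × F} {y : Fin h → F} {X : Fin r → F × F}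
    (hy : Function.Injective y) (hl : ∀ i, ¬ On l (X i))
    (hxy : ∀ i k, (X i).1 ≠ y k) (hXx : ∀ i j, i ≠ j → (X i).1 ≠ (X j).1)
    (hXX : ∀ i j k, i ≠ j → ¬ On (lineThrough (X i) (X j)) (linePoint l (y k))) :
    Function.Injective (lineFlags (l, y, X)) := by
  have honX : ∀ i k, On (lineThrough (X i) (linePoint l (y k))) (X i) :=
    fun i k => on_lineThrough_left _ _
  have honY : ∀ i k, On (lineThrough (X i) (linePoint l (y k))) (linePoint l (y k)) :=
    fun i k => on_lineThrough_right (hxy i k)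
  have hne : ∀ i k, lineThrough (X i) (linePoint l (y k)) ≠ l :=
    fun i k h => hl i (h ▸ honX i k)
  have hk : ∀ i j k k', lineThrough (X i) (linePoint l (y k)) =
      lineThrough (X j) (linePoint l (y k')) → k = k' := by
    intro i j k k' h
    by_contra hkk
    refine hne i k ((honY i k).line_eq (h ▸ honY j k') (on_linePoint l _) (on_linePoint l _) ?_)
    exact fun h => hkk (hy h)
  have hi : ∀ i j k k', lineThrough (X i) (linePoint l (y k)) =
      lineThrough (X j) (linePoint l (y k')) → i = j := by
    intro i j k k' h
    by_contra hij
    refine hXX i j k hij ?_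
    rw [← (honX i k).eq_lineThrough (h ▸ honX j k') (hXx i j hij)]
    exact honY i k
  rintro (k | ⟨i, k⟩ | ⟨i, k⟩) (k' | ⟨i', k'⟩ | ⟨i', k'⟩) h <;>
    simp only [lineFlags, Prod.mk.injEq] at h
  · rw [hy h.2]
  · exact absurd h.1.symm (hne _ _)
  · exact absurd h.1.symm (hne _ _)
  · exact absurd h.1 (hne _ _)
  · rw [hk _ _ _ _ h.1, hi _ _ _ _ h.1]
  · exact absurd h.2 (hxy _ _)
  · exact absurd h.1 (hne _ _)
  · exact absurd h.2.symm (hxy _ _)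
  · rw [hk _ _ _ _ h.1, hi _ _ _ _ h.1]

/-- Greedy choice: lines spanned by `v` chosen points cover at most `v ^ 2 * m` points of `P`. -/
theorem exists_subset_card_eq_general_position {P : Finset (F × F)}
    (hP : ∀ p ∈ P, ∀ p' ∈ P, p ≠ p' → p.1 ≠ p'.1) {m : ℕ}
    (hm : ∀ l, (P.filter fun p => On l p).card ≤ m) (v : ℕ) (hv : v ^ 2 * m + v ≤ P.card) :
    ∃ T ⊆ P, T.card = v ∧ ∀ a ∈ T, ∀ b ∈ T, ∀ z ∈ T, a ≠ b → z ≠ a → z ≠ b →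
      ¬ On (lineThrough a b) z := by
  induction v with
  | zero => exact ⟨∅, by simp, rfl, by simp⟩
  | succ v ih =>
    obtain ⟨T, hTP, hTv, hT⟩ := ih (le_trans (by gcongr <;> omega) hv)
    set B := T ∪ (T ×ˢ T).biUnion fun e => P.filter fun p => On (lineThrough e.1 e.2) p with hB
    have hBc : B.card < P.card := by
      have h1 : B.card ≤ v + v * v * m := by
        refine (card_union_le _ _).trans ?_
        rw [hTv]
        gcongr
        refine (card_biUnion_le_card_mul _ _ m fun e _ => hm _).trans ?_
        rw [card_product, hTv]
      nlinarith
    obtain ⟨z, hzP, hzB⟩ := exists_mem_notMem_of_card_lt_card hBc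
    simp only [hB, mem_union, mem_biUnion, mem_product, mem_filter, not_or, not_exists,
      not_and] at hzB
    obtain ⟨hzT, hz⟩ := hzB
    have hz' : ∀ a ∈ T, ∀ b ∈ T, ¬ On (lineThrough a b) z := fun a ha b hb =>
      hz (a, b) ⟨ha, hb⟩ hzP
    refine ⟨insert z T, insert_subset hzP hTP, by rw [card_insert_of_notMem hzT, hTv], ?_⟩
    intro a ha b hb w hw hab hwa hwb hon
    have hfst : ∀ p ∈ insert z T, ∀ p' ∈ insert z T, p ≠ p' → p.1 ≠ p'.1 := fun p hp p' hp' =>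
      hP p (insert_subset hzP hTP hp) p' (insert_subset hzP hTP hp')
    have hona := on_lineThrough_left a b
    have honb := on_lineThrough_right (hfst a ha b hb hab)
    -- Collinearity is symmetric: whichever of the three points is the new `z`, it lies on the line
    -- through the other two.
    have h1 := hon.eq_lineThrough hona (hfst w hw a ha hwa)
    have h2 := hon.eq_lineThrough honb (hfst w hw b hb hwb)
    rw [mem_insert] at ha hb hw
    rcases ha with rfl | ha
    · have hb := hb.resolve_left hab.symm
      have hw := hw.resolve_left hwa
      exact hz' w hw b hb (h2 ▸ hona)
    rcases hb with rfl | hb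
    · have hw := hw.resolve_left hwb
      exact hz' w hw a ha (h1 ▸ honb)
    rcases hw with rfl | hw
    · exact hz' a ha b hb hon
    · exact hT a ha b hb w hw hab hwa hwb hon

/-- Either no line is rich in `P`, and the greedy choice gives general position, or a line has more
than `h + r ^ 2` points of `P`, of which at most `r ^ 2` are spoiled by lines joining two of the `r`
outside points. -/
theorem exists_flags_of_points {K s r h v : ℕ} [NeZero K] {c : FlagColoring F K s}
    {P : Finset (F × F)}
    (hP : ∀ p ∈ P, ∀ p' ∈ P, p ≠ p' → p.1 ≠ p'.1)
    (hc : ∀ p ∈ P, ∀ p' ∈ P, p ≠ p' → ∀ l, On l p → On l p' → (c (l, p.1)).1 = 0)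
    (hs : ∀ l, (P.filter fun p => On l p).card ≤ s) (hcard : s + r ≤ P.card)
    (hbig : v ^ 2 * (h + r ^ 2) + v ≤ s + r) (hh : 2 ≤ h) :
    (∃ d : Fin v → F × F, Function.Injective (pairFlags d) ∧
      ∀ i, (c (pairFlags d i)).1 = 0) ∨
    ∃ d : (F × F) × (Fin h → F) × (Fin r → F × F), Function.Injective (lineFlags d) ∧
      ∀ i, (c (lineFlags d i)).1 = 0 := by
  by_cases hm : ∀ l, (P.filter fun p => On l p).card ≤ h + r ^ 2
  · left
    obtain ⟨T, hTP, hTv, hT⟩ :=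
      exists_subset_card_eq_general_position hP hm v (hbig.trans hcard)
    let e : Fin v ≃ T := (finCongr hTv.symm).trans T.equivFin.symm
    have hinj : Function.Injective fun i => (e i : F × F) :=
      Subtype.val_injective.comp e.injective
    have hx : ∀ i j, i ≠ j → (e i : F × F).1 ≠ (e j : F × F).1 := fun i j hij =>
      hP _ (hTP (e i).2) _ (hTP (e j).2) (hinj.ne hij)
    refine ⟨fun i => (e i : F × F), pairFlags_injective ?_ ?_, ?_⟩
    · intro i j hij
      by_contra hne
      exact hx i j hne hij
    · intro i j k hij hki hkj
      exact hT _ (e i).2 _ (e j).2 _ (e k).2 (hinj.ne hij) (hinj.ne hki) (hinj.ne hkj)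
    · rintro ⟨⟨i, j⟩, hij⟩
      exact hc _ (hTP (e i).2) _ (hTP (e j).2) (hinj.ne hij) _ (on_lineThrough_left _ _)
        (on_lineThrough_right (hx i j hij))
  · right
    push Not at hm
    obtain ⟨l, hl⟩ := hm
    have hout : r ≤ (P.filter fun p => ¬ On l p).card := by
      have := card_filter_add_card_filter_not (s := P) (fun p => On l p)
      have := hs l
      omega
    obtain ⟨X, hXP, hXr⟩ := exists_subset_card_eq hout
    have hXP' : ∀ x ∈ X, x ∈ P ∧ ¬ On l x := fun x hx => mem_filter.1 (hXP hx)
    set A := P.filter fun p => On l p with hA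
    set B := X.offDiag.biUnion fun e => A.filter fun p => On (lineThrough e.1 e.2) p with hB
    have hBc : B.card ≤ r ^ 2 := by
      refine (card_biUnion_le_card_mul _ _ 1 ?_).trans ?_
      · rintro ⟨x, x'⟩ hxx
        rw [mem_offDiag] at hxx
        rw [card_le_one]
        intro a ha b hb
        simp only [hA, mem_filter] at ha hb
        by_contra hab
        refine (hXP' x hxx.1).2 ?_
        rw [ha.1.2.line_eq hb.1.2 ha.2 hb.2 (hP _ ha.1.1 _ hb.1.1 hab)]
        exact on_lineThrough_left _ _
      · rw [offDiag_card, hXr, mul_one, sq]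
        exact Nat.sub_le _ _
    have hAB : h ≤ (A \ B).card := by
      have := le_card_sdiff B A
      omega
    obtain ⟨Y, hYA, hYh⟩ := exists_subset_card_eq hAB
    have hYP : ∀ y ∈ Y, y ∈ P ∧ On l y := fun y hy =>
      mem_filter.1 (mem_sdiff.1 (hYA hy)).1
    let e : Fin h ≃ Y := (finCongr hYh.symm).trans Y.equivFin.symm
    let e' : Fin r ≃ X := (finCongr hXr.symm).trans X.equivFin.symm
    have hinj : Function.Injective fun i => (e i : F × F) :=
      Subtype.val_injective.comp e.injective
    have hinj' : Function.Injective fun i => (e' i : F × F) :=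
      Subtype.val_injective.comp e'.injective
    have hlp : ∀ k, linePoint l (e k : F × F).1 = e k := fun k => (hYP _ (e k).2).2.linePoint_eq
    have hXY : ∀ i k, (e' i : F × F) ≠ e k := fun i k hik =>
      (hXP' _ (e' i).2).2 (hik ▸ (hYP _ (e k).2).2)
    have hXYx : ∀ i k, (e' i : F × F).1 ≠ (e k : F × F).1 := fun i k =>
      hP _ (hXP' _ (e' i).2).1 _ (hYP _ (e k).2).1 (hXY i k)
    refine ⟨(l, fun k => (e k : F × F).1, fun i => (e' i : F × F)),
      lineFlags_injective ?_ ?_ hXYx ?_ ?_, ?_⟩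
    · intro i j hij
      by_contra hne
      exact hP _ (hYP _ (e i).2).1 _ (hYP _ (e j).2).1 (hinj.ne hne) hij
    · exact fun i => (hXP' _ (e' i).2).2
    · exact fun i j hij => hP _ (hXP' _ (e' i).2).1 _ (hXP' _ (e' j).2).1 (hinj'.ne hij)
    · intro i j k hij hon
      rw [hlp] at hon
      refine (mem_sdiff.1 (hYA (e k).2)).2 ?_
      rw [hB, mem_biUnion]
      refine ⟨(e' i, e' j), mem_offDiag.2 ⟨(e' i).2, (e' j).2, hinj'.ne hij⟩, ?_⟩
      exact mem_filter.2 ⟨(mem_sdiff.1 (hYA (e k).2)).1, hon⟩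
    · have hcc : ∀ i k, (c (lineThrough (e' i : F × F) (e k), (e' i : F × F).1)).1 = 0 ∧
          (c (lineThrough (e' i : F × F) (e k), (e k : F × F).1)).1 = 0 := fun i k =>
        ⟨hc _ (hXP' _ (e' i).2).1 _ (hYP _ (e k).2).1 (hXY i k) _ (on_lineThrough_left _ _)
          (on_lineThrough_right (hXYx i k)),
        hc _ (hYP _ (e k).2).1 _ (hXP' _ (e' i).2).1 (hXY i k).symm _
          (on_lineThrough_right (hXYx i k)) (on_lineThrough_left _ _)⟩
      rintro (k | ⟨i, k⟩ | ⟨i, k⟩)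
      -- A flag on `l` is known to be active only through a second clique point on `l`, hence `2 ≤
      -- h`.
      · have : Nontrivial (Fin h) := Fin.nontrivial_iff_two_le.2 hh
        obtain ⟨k', hk'⟩ := exists_ne k
        exact hc _ (hYP _ (e k).2).1 _ (hYP _ (e k').2).1 (hinj.ne hk'.symm) l
          (hYP _ (e k).2).2 (hYP _ (e k').2).2
      · simpa only [lineFlags, hlp] using (hcc i k).1
      · simpa only [lineFlags, hlp] using (hcc i k).2

theorem exists_flags_of_isClique {V : Type*} {K s r h v : ℕ} [NeZero K]
    {c : FlagColoring F K s} {f : V → F × F} {W : Finset V}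
    (hW : (flagGraph f c).IsNClique (s + r) W)
    (hbig : v ^ 2 * (h + r ^ 2) + v ≤ s + r) (hh : 2 ≤ h) :
    (∃ d : Fin v → F × F, Function.Injective (pairFlags d) ∧
      ∀ i, (c (pairFlags d i)).1 = 0) ∨
    ∃ d : (F × F) × (Fin h → F) × (Fin r → F × F), Function.Injective (lineFlags d) ∧
      ∀ i, (c (lineFlags d i)).1 = 0 := by
  have hadj : ∀ u ∈ W, ∀ w ∈ W, f u ≠ f w → (flagGraph f c).Adj u w := fun u hu w hw huw =>
    hW.1 hu hw fun h => huw (h ▸ rfl)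
  have hinj : Set.InjOn f (W : Set V) := by
    intro u hu w hw huw
    by_contra hne
    exact flagGraph_adj_fst_ne (hW.1 hu hw hne) (by rw [huw])
  refine exists_flags_of_points (P := W.image f) ?_ ?_ ?_ ?_ hbig hh
  · simp only [mem_image, forall_exists_index, and_imp, forall_apply_eq_imp_iff₂]
    exact fun u hu w hw huw => flagGraph_adj_fst_ne (hadj u hu w hw huw)
  · simp only [mem_image, forall_exists_index, and_imp, forall_apply_eq_imp_iff₂]
    exact fun u hu w hw huw l hlu hlw => (flagGraph_adj_of_on (hadj u hu w hw huw) hlu hlw).1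
  · intro l
    rw [filter_image]
    exact card_image_le.trans (card_on_le_of_isClique hW.1 l)
  · rw [card_image_of_injOn hinj, hW.2]

end Configurations

/-! ### Existence of a good colouring -/

section Existence

variable {F V : Type*} [Field F] [Fintype F] {K s : ℕ} [NeZero K]

/-- Each of the distinct flags of a configuration is active for `s` of its `K * s` colours, a factor
`1 / K` per flag. -/
theorem card_filter_exists_active_mul_le {F D ι : Type*} [Fintype F] [Fintype D] [Fintype ι] (hs : 0 < s)
    (g : D → ι → (F × F) × F) :
    (univ.filter fun c : FlagColoring F K s =>
        ∃ d, Function.Injective (g d) ∧ ∀ i, (c (g d i)).1 = 0).card *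
      K ^ Fintype.card ι ≤ Fintype.card D * Fintype.card (FlagColoring F K s) := by
  have h := card_filter_exists_forall_mem_mul_le (α := (F × F) × F) (β := Fin K × Fin s)
    (univ.filter fun d : D => Function.Injective (g d)) (fun d => univ.image (g d))
    (fun _ _ => {(0 : Fin K)} ×ˢ univ) (Fintype.card ι) s
    (fun d hd => by rw [card_image_of_injective _ (mem_filter.1 hd).2, card_univ])
    (fun d _ a _ => by simp)
  have heq : (univ.filter fun c : FlagColoring F K s =>
        ∃ d, Function.Injective (g d) ∧ ∀ i, (c (g d i)).1 = 0) =
      univ.filter fun c : FlagColoring F K s =>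
        ∃ d ∈ univ.filter fun d : D => Function.Injective (g d),
          ∀ a ∈ univ.image (g d), c a ∈ ({(0 : Fin K)} ×ˢ univ : Finset (Fin K × Fin s)) := by
    ext c
    simp only [mem_filter, mem_univ, true_and, mem_image, forall_exists_index,
      forall_apply_eq_imp_iff, mem_product, mem_singleton, and_true]
  rw [heq]
  refine Nat.le_of_mul_le_mul_right ?_ (pow_pos hs (Fintype.card ι))
  calc _ = _ * Fintype.card (Fin K × Fin s) ^ Fintype.card ι := by
        rw [Fintype.card_prod, Fintype.card_fin, Fintype.card_fin, mul_pow, mul_assoc]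
        congr!
    _ ≤ _ := h
    _ ≤ Fintype.card D * s ^ Fintype.card ι * Fintype.card (FlagColoring F K s) := by
        gcongr
        exact card_filter_le _ _
    _ = _ := by ring

/-- The line `l` meets the point set `S` in active flags of all colours. -/
def IsRainbowOn (c : FlagColoring F K s) (S : Finset (F × F)) (l : F × F) : Prop :=
  ∀ i : Fin s, ∃ p ∈ S, On l p ∧ c (l, p.1) = (0, i)

/-- If `S` has no rainbow line, choose a missing colour for each of the `q ^ 2` lines. Every point
of `S` is on `q` lines, so `M * q` distinct flags each avoid one value; the union runs over `S` and
the missing colours. -/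
theorem card_filter_exists_not_isRainbowOn_mul_le (M : ℕ) :
    (univ.filter fun c : FlagColoring F K s =>
        ∃ S : Finset (F × F), S.card = M ∧ ∀ l, ¬ IsRainbowOn c S l).card *
      (K * s) ^ (M * Fintype.card F) ≤
    (Fintype.card F ^ 2) ^ M * s ^ Fintype.card F ^ 2 *
      (K * s - 1) ^ (M * Fintype.card F) * Fintype.card (FlagColoring F K s) := by
  set flag : (F × F) × F → (F × F) × F := fun e => ((e.2, e.1.2 - e.2 * e.1.1), e.1.1)
    with hflag
  have hinj : Function.Injective flag := by
    rintro ⟨⟨x, y⟩, a⟩ ⟨⟨x', y'⟩, a'⟩ h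
    simp only [hflag, Prod.mk.injEq] at h
    obtain ⟨⟨rfl, h⟩, rfl⟩ := h
    simpa using h
  have h := card_filter_exists_forall_mem_mul_le (α := (F × F) × F) (β := Fin K × Fin s)
    ((univ : Finset (F × F)).powersetCard M ×ˢ (univ : Finset (F × F → Fin s)))
    (fun d => (d.1 ×ˢ univ).image flag) (fun d a => {((0 : Fin K), d.2 a.1)}ᶜ)
    (M * Fintype.card F) (K * s - 1)
    (fun d hd => by
      rw [card_image_of_injective _ hinj, card_product, card_univ,
        (mem_powersetCard.1 (mem_product.1 hd).1).2])
    (fun d _ a _ => by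
      rw [card_compl, card_singleton, Fintype.card_prod, Fintype.card_fin, Fintype.card_fin])
  rw [Fintype.card_prod, Fintype.card_fin, Fintype.card_fin] at h
  refine le_trans ?_ (h.trans ?_)
  · gcongr with c
    rintro ⟨S, hS, hc⟩
    simp only [IsRainbowOn, not_forall, not_exists, not_and] at hc
    choose i hi using hc
    refine ⟨(S, i), mem_product.2 ⟨mem_powersetCard.2 ⟨subset_univ _, hS⟩, mem_univ _⟩, ?_⟩
    intro a ha
    rw [mem_image] at ha
    obtain ⟨⟨p, t⟩, hp, rfl⟩ := ha
    rw [mem_compl, mem_singleton]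
    refine hi _ p (mem_product.1 hp).1 ?_
    simp [On]
  · gcongr
    rw [card_product, card_powersetCard, card_univ, card_univ, Fintype.card_fun,
      Fintype.card_fin, Fintype.card_prod, ← sq]
    gcongr
    exact Nat.choose_le_pow _ _

theorem card_le_card_filter_adj_mul {f : V → F × F} (hs : 2 ≤ s) {u w : V}
    (huw : (f u).1 ≠ (f w).1) :
    Fintype.card (FlagColoring F K s) ≤
      (univ.filter fun c : FlagColoring F K s => (flagGraph f c).Adj u w).card *
        (K * s) ^ 2 := by
  set l := lineThrough (f u) (f w) with hl
  have hne : (l, (f u).1) ≠ (l, (f w).1) := fun h => huw (Prod.ext_iff.1 h).2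
  have h := card_filter_forall_mem_mul (α := (F × F) × F) (β := Fin K × Fin s)
    {(l, (f u).1), (l, (f w).1)}
    (fun a => if a = (l, (f u).1) then {((0 : Fin K), (⟨0, by omega⟩ : Fin s))}
      else {((0 : Fin K), (⟨1, by omega⟩ : Fin s))}) 1 (fun a _ => by split_ifs <;> simp)
  rw [card_pair hne, one_pow, one_mul, Fintype.card_prod, Fintype.card_fin,
    Fintype.card_fin] at h
  rw [← h]
  gcongr with c
  intro hc
  have h1 := hc (l, (f u).1) (by simp)
  have h2 := hc (l, (f w).1) (by simp)
  rw [if_pos rfl, mem_singleton] at h1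
  rw [if_neg hne.symm, mem_singleton] at h2
  exact ⟨l, on_lineThrough_left _ _, on_lineThrough_right huw, by rw [h1], by rw [h2],
    by rw [h1, h2]; simp⟩

/-- A vertical line carries at most `q * B ≤ 2 * card V / q ≤ card V / 2` vertices, as `q ≥ 4`. -/
theorem sq_card_le_two_mul_card_filter_fst_ne {F V : Type*} [Fintype F]
    [Fintype V] {f : V → F × F} {B : ℕ}
    (hF : 4 ≤ Fintype.card F) (hB : ∀ p, (univ.filter fun u => f u = p).card ≤ B)
    (hBV : Fintype.card F ^ 2 * B ≤ 2 * Fintype.card V) :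
    Fintype.card V ^ 2 ≤
      2 * (univ.filter fun e : V × V => (f e.1).1 ≠ (f e.2).1).card := by
  have h1 : ∀ a, (univ.filter fun w => (f w).1 = a).card ≤ Fintype.card F * B := by
    intro a
    have : (univ.filter fun w => (f w).1 = a) ⊆
        univ.biUnion fun b : F => univ.filter fun w => f w = (a, b) := by
      intro w hw
      simpa [Prod.ext_iff] using hw
    exact (card_le_card this).trans (card_biUnion_le_card_mul _ _ _ fun b _ => hB (a, b))
  have h2 : (univ.filter fun e : V × V => (f e.1).1 = (f e.2).1).card ≤
      Fintype.card V * (Fintype.card F * B) := by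
    have : (univ.filter fun e : V × V => (f e.1).1 = (f e.2).1) ⊆
        univ.biUnion fun u : V =>
          (univ.filter fun w => (f w).1 = (f u).1).image fun w => (u, w) := by
      rintro ⟨u, w⟩ he
      simpa [eq_comm] using he
    exact (card_le_card this).trans (card_biUnion_le_card_mul _ _ _ fun b _ =>
      card_image_le.trans (h1 _))
  have h3 := card_filter_add_card_filter_not (s := (univ : Finset (V × V)))
    (fun e => (f e.1).1 = (f e.2).1)
  rw [card_univ, Fintype.card_prod] at h3
  have h4 : 2 * (Fintype.card F * B) ≤ Fintype.card V := by nlinarith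
  nlinarith

theorem exists_flagColoring [Fintype V] [Nonempty V] (f : V → F × F) {r h v M B : ℕ}
    (hs : 2 ≤ s) (hh : 2 ≤ h) (hbig : v ^ 2 * (h + r ^ 2) + v ≤ s + r)
    (hF : 4 ≤ Fintype.card F) (hB : ∀ p, (univ.filter fun u => f u = p).card ≤ B)
    (hBV : Fintype.card F ^ 2 * B ≤ 2 * Fintype.card V)
    (hpair : 16 * (K * s) ^ 2 * (Fintype.card F ^ 2) ^ v ≤ K ^ (v * (v - 1)))
    (hline : 16 * (K * s) ^ 2 *
      (Fintype.card F ^ 2 * (Fintype.card F ^ h * (Fintype.card F ^ 2) ^ r)) ≤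
        K ^ (h + (r * h + r * h)))
    (hrain : 16 * (K * s) ^ 2 * ((Fintype.card F ^ 2) ^ M * s ^ Fintype.card F ^ 2 *
      (K * s - 1) ^ (M * Fintype.card F)) ≤ (K * s) ^ (M * Fintype.card F)) :
    ∃ c : FlagColoring F K s, (flagGraph f c).CliqueFree (s + r) ∧
      (∀ S : Finset (F × F), S.card = M → ∃ l, IsRainbowOn c S l) ∧
      Fintype.card V ^ 2 ≤ 4 * (K * s) ^ 2 *
        (univ.filter fun e : V × V => (flagGraph f c).Adj e.1 e.2).card := by
  have hK : 0 < K := NeZero.pos K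
  have : NeZero s := ⟨by omega⟩
  set Q := (K * s) ^ 2 with hQ
  set Ω := Fintype.card (FlagColoring F K s) with hΩ
  have hΩ0 : 0 < Ω := Fintype.card_pos
  have scale : ∀ {a X Y : ℕ}, 0 < Y → a * Y ≤ X * Ω → 16 * Q * X ≤ Y → 16 * Q * a ≤ Ω := by
    intro a X Y hY h1 h2
    refine Nat.le_of_mul_le_mul_right (c := Y) ?_ hY
    calc 16 * Q * a * Y = 16 * Q * (a * Y) := by ring
      _ ≤ 16 * Q * (X * Ω) := by gcongr
      _ = 16 * Q * X * Ω := by ring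
      _ ≤ Y * Ω := by gcongr
      _ = Ω * Y := mul_comm _ _
  set A₁ := univ.filter fun c : FlagColoring F K s =>
    ∃ d : Fin v → F × F, Function.Injective (pairFlags d) ∧ ∀ i, (c (pairFlags d i)).1 = 0
    with hA₁
  set A₂ := univ.filter fun c : FlagColoring F K s =>
    ∃ d : (F × F) × (Fin h → F) × (Fin r → F × F), Function.Injective (lineFlags d) ∧
      ∀ i, (c (lineFlags d i)).1 = 0 with hA₂
  set A₃ := univ.filter fun c : FlagColoring F K s =>
    ∃ S : Finset (F × F), S.card = M ∧ ∀ l, ¬ IsRainbowOn c S l with hA₃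
  have b₁ : 16 * Q * A₁.card ≤ Ω := by
    refine scale (pow_pos hK _) (card_filter_exists_active_mul_le (by omega) _) ?_
    have : Fintype.card {p : Fin v × Fin v // p.1 ≠ p.2} = v * (v - 1) := by
      have h1 : (univ.filter fun p : Fin v × Fin v => p.1 ≠ p.2) = univ.offDiag := by
        ext; simp
      rw [Fintype.card_subtype, h1, offDiag_card, card_univ, Fintype.card_fin,
        Nat.mul_sub_one]
    rw [this, Fintype.card_fun, Fintype.card_prod, ← sq, Fintype.card_fin]
    exact hpair
  have b₂ : 16 * Q * A₂.card ≤ Ω := by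
    refine scale (pow_pos hK _) (card_filter_exists_active_mul_le (by omega) _) ?_
    simpa only [Fintype.card_sum, Fintype.card_prod, Fintype.card_fin, Fintype.card_fun,
      ← sq] using hline
  have b₃ : 16 * Q * A₃.card ≤ Ω :=
    scale (pow_pos (by positivity) _) (card_filter_exists_not_isRainbowOn_mul_le M) hrain
  set A := A₁ ∪ A₂ ∪ A₃ with hA
  have bA : 16 * Q * A.card ≤ 3 * Ω := by
    have h1 := card_union_le A₁ A₂
    have h2 := card_union_le (A₁ ∪ A₂) A₃
    calc 16 * Q * A.card ≤ 16 * Q * (A₁.card + A₂.card + A₃.card) := by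
          gcongr
          rw [hA]
          omega
      _ ≤ 3 * Ω := by linarith
  set E : FlagColoring F K s → ℕ := fun c =>
    (univ.filter fun e : V × V => (flagGraph f c).Adj e.1 e.2).card with hE
  have hEV : ∀ c, E c ≤ Fintype.card V ^ 2 := fun c => by
    refine (card_filter_le _ _).trans ?_
    rw [card_univ, Fintype.card_prod, sq]
  have hmean : Fintype.card V ^ 2 * Ω ≤ 2 * Q * ∑ c, E c := by
    have h1 : ∑ c, E c = ∑ e : V × V,
        (univ.filter fun c : FlagColoring F K s => (flagGraph f c).Adj e.1 e.2).card := by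
      simp only [hE, card_filter]
      exact sum_comm
    have h2 := sq_card_le_two_mul_card_filter_fst_ne hF hB hBV
    calc Fintype.card V ^ 2 * Ω
        ≤ 2 * (univ.filter fun e : V × V => (f e.1).1 ≠ (f e.2).1).card * Ω := by gcongr
      _ = 2 * ∑ e ∈ univ.filter fun e : V × V => (f e.1).1 ≠ (f e.2).1, Ω := by
          rw [sum_const, smul_eq_mul, mul_assoc]
      _ ≤ 2 * ∑ e ∈ univ.filter fun e : V × V => (f e.1).1 ≠ (f e.2).1,
          (univ.filter fun c : FlagColoring F K s => (flagGraph f c).Adj e.1 e.2).card * Q := by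
          gcongr with e he
          exact card_le_card_filter_adj_mul hs (mem_filter.1 he).2
      _ ≤ 2 * ∑ e : V × V,
          (univ.filter fun c : FlagColoring F K s => (flagGraph f c).Adj e.1 e.2).card * Q := by
          gcongr
          exact subset_univ _
      _ = 2 * Q * ∑ c, E c := by
          rw [h1, ← sum_mul]
          ring
  -- The mean of `E` is at least `card V ^ 2 / (2 * Q)`. Were the claim false, colourings outside
  -- `A` would contribute at most `1 / (4 * Q)` and those in `A` at most `3 / (16 * Q)` of `card V ^
  -- 2`, which is too little.
  obtain ⟨c, hcA, hcE⟩ : ∃ c ∉ A, Fintype.card V ^ 2 ≤ 4 * Q * E c := by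
    by_contra! hcon
    have hV : 0 < Fintype.card V ^ 2 := pow_pos Fintype.card_pos 2
    have h1 : ∑ c, 4 * Q * E c ≤ ∑ c, (Fintype.card V ^ 2 +
        if c ∈ A then 4 * Q * Fintype.card V ^ 2 else 0) := by
      refine sum_le_sum fun c _ => ?_
      split_ifs with hc
      · have := Nat.mul_le_mul_left (4 * Q) (hEV c)
        omega
      · simpa using (hcon c hc).le
    rw [← mul_sum, sum_add_distrib, sum_const, card_univ, ← sum_filter, sum_const,
      filter_univ_mem, smul_eq_mul, smul_eq_mul] at h1
    have h2 : A.card * (4 * Q * Fintype.card V ^ 2) * 4 ≤ 3 * Ω * Fintype.card V ^ 2 := by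
      calc _ = 16 * Q * A.card * Fintype.card V ^ 2 := by ring
        _ ≤ _ := by gcongr
    have h3 : 0 < Fintype.card V ^ 2 * Ω := by positivity
    have h4 : Fintype.card (FlagColoring F K s) = Ω := rfl
    rw [h4] at h1
    nlinarith
  simp only [hA, hA₁, hA₂, hA₃, mem_union, mem_filter, mem_univ, true_and, not_or] at hcA
  refine ⟨c, ?_, ?_, hcE⟩
  · intro W hW
    rcases exists_flags_of_isClique hW hbig hh with h | h
    · exact hcA.1.1 h
    · exact hcA.1.2 h
  · intro S hS
    by_contra! hcon
    exact hcA.2 ⟨S, hS, hcon⟩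

end Existence

/-! ### From colourings to Ramsey–Turán numbers -/

section RamseyTuran

open RamseyTuran

theorem bddAbove_cliqueFree_card {V : Type*} [Fintype V] (G : SimpleGraph V) (s : ℕ) :
    BddAbove {m : ℕ | ∃ U : Finset V, (G.induce (U : Set V)).CliqueFree s ∧ U.card = m} :=
  ⟨Fintype.card V, by rintro _ ⟨U, -, rfl⟩; exact card_le_univ U⟩

theorem exists_card_eq_sIndepNum {V : Type*} [Fintype V] (G : SimpleGraph V) {s : ℕ}
    (hs : 0 < s) :
    ∃ U : Finset V, (G.induce (U : Set V)).CliqueFree s ∧ U.card = sIndepNum G s := by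
  suffices h : (G.induce ((∅ : Finset V) : Set V)).CliqueFree s from
    Nat.sSup_mem (s := {m : ℕ | ∃ U : Finset V, (G.induce (U : Set V)).CliqueFree s ∧
      U.card = m}) ⟨0, ∅, h, rfl⟩ (bddAbove_cliqueFree_card G s)
  intro W hW
  have h0 : W = ∅ := by
    ext w
    exact absurd w.2 (by simp)
  have := hW.2
  rw [h0, card_empty] at this
  omega

theorem ncard_edgeSet_le_ramseyTuranNum {n s : ℕ} {W : Type*} {H : SimpleGraph W} {x : ℝ}
    {G : SimpleGraph (Fin n)} (hH : H.Free G) (hs : (sIndepNum G s : ℝ) < x) :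
    G.edgeSet.ncard ≤ ramseyTuranNum s n H x :=
  le_csSup ((Set.finite_range fun G : SimpleGraph (Fin n) => G.edgeSet.ncard).bddAbove.mono
    (by rintro _ ⟨G, -, -, rfl⟩; exact ⟨G, rfl⟩)) ⟨G, hH, hs, rfl⟩

/-- `M * B` vertices occupy at least `M` points, and one vertex per colour on a rainbow line gives a
`K_s`. -/
theorem card_lt_of_cliqueFree_induce {F V : Type*} [Field F] {K s M B : ℕ} [NeZero K]
    [Fintype V] {f : V → F × F} {c : FlagColoring F K s}
    (hB : ∀ p, (univ.filter fun u => f u = p).card ≤ B)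
    (hc : ∀ S : Finset (F × F), S.card = M → ∃ l, IsRainbowOn c S l)
    {U : Finset V} (hU : ((flagGraph f c).induce (U : Set V)).CliqueFree s)
    (hB0 : 0 < B) : U.card < M * B := by
  by_contra! hcard
  have himg : M ≤ (U.image f).card := by
    have : U.card ≤ B * (U.image f).card :=
      card_le_mul_card_image U B fun p _ =>
        (card_le_card (filter_subset_filter _ (subset_univ U))).trans (hB p)
    refine Nat.le_of_mul_le_mul_right ?_ hB0
    linarith
  obtain ⟨S, hSU, hSM⟩ := exists_subset_card_eq himg
  obtain ⟨l, hl⟩ := hc S hSM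
  have hex : ∀ i : Fin s, ∃ u ∈ U, On l (f u) ∧ c (l, (f u).1) = (0, i) := by
    intro i
    obtain ⟨p, hp, h1, h2⟩ := hl i
    obtain ⟨u, hu, rfl⟩ := mem_image.1 (hSU hp)
    exact ⟨u, hu, h1, h2⟩
  choose g hgU hgl hgc using hex
  have hadj : ∀ i j, i ≠ j → (flagGraph f c).Adj (g i) (g j) := fun i j hij =>
    ⟨l, hgl i, hgl j, by rw [hgc], by rw [hgc], by rwa [hgc, hgc]⟩
  have hinj : Function.Injective fun i => (⟨g i, hgU i⟩ : (U : Set V)) := by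
    intro i j hij
    by_contra hne
    exact (hadj i j hne).ne (Subtype.ext_iff.1 hij)
  refine hU (univ.image fun i => (⟨g i, hgU i⟩ : (U : Set V))) ⟨?_, ?_⟩
  · intro a ha b hb hab
    simp only [coe_image, coe_univ, Set.image_univ, Set.mem_range] at ha hb
    obtain ⟨i, rfl⟩ := ha
    obtain ⟨j, rfl⟩ := hb
    exact hadj i j fun h => hab (h ▸ rfl)
  · rw [card_image_of_injective _ hinj, card_univ, Fintype.card_fin]

theorem sq_le_mul_ramseyTuranNum_of_nat {q n K s r h v M B : ℕ} [Fact q.Prime] [NeZero K]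
    {x : ℝ} (hn : 0 < n) (hs : 2 ≤ s) (hh : 2 ≤ h)
    (hbig : v ^ 2 * (h + r ^ 2) + v ≤ s + r) (hq : 4 ≤ q)
    (hnB : n ≤ q ^ 2 * B) (hBn : q ^ 2 * B ≤ 2 * n)
    (hpair : 16 * (K * s) ^ 2 * (q ^ 2) ^ v ≤ K ^ (v * (v - 1)))
    (hline : 16 * (K * s) ^ 2 * (q ^ 2 * (q ^ h * (q ^ 2) ^ r)) ≤ K ^ (h + (r * h + r * h)))
    (hrain : 16 * (K * s) ^ 2 * ((q ^ 2) ^ M * s ^ q ^ 2 * (K * s - 1) ^ (M * q)) ≤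
      (K * s) ^ (M * q))
    (hx : (M * B : ℝ) ≤ x) :
    n ^ 2 ≤ 8 * (K * s) ^ 2 *
      ramseyTuranNum s n (SimpleGraph.completeGraph (Fin (s + r))) x := by
  have hcard : Fintype.card (ZMod q) = q := ZMod.card q
  have hB0 : 0 < B := by
    rcases Nat.eq_zero_or_pos B with rfl | h
    · omega
    · exact h
  obtain ⟨e⟩ : Nonempty (Fin n ↪ (ZMod q × ZMod q) × Fin B) := by
    refine Function.Embedding.nonempty_of_card_le ?_
    rw [Fintype.card_prod, Fintype.card_prod, hcard, Fintype.card_fin, Fintype.card_fin, ← sq]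
    exact hnB
  have : Nonempty (Fin n) := ⟨⟨0, hn⟩⟩
  have hfib : ∀ p, (univ.filter fun u => (e u).1 = p).card ≤ B := by
    intro p
    have := card_le_card_of_injOn (s := univ.filter fun u => (e u).1 = p)
      (t := (univ : Finset (Fin B))) (fun u => (e u).2) (by simp) ?_
    · simpa using this
    · intro u hu w hw huw
      rw [mem_coe, mem_filter] at hu hw
      exact e.injective (Prod.ext (hu.2.trans hw.2.symm) huw)
  obtain ⟨c, hfree, hrb, hE⟩ := exists_flagColoring (F := ZMod q) (K := K) (r := r) (M := M)
    (fun u => (e u).1) hs hh hbig (by rwa [hcard])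
    (fun p => by convert hfib p)
    (by rwa [hcard, Fintype.card_fin]) (by rwa [hcard]) (by rwa [hcard]) (by rwa [hcard])
  set G := flagGraph (fun u => (e u).1) c with hG
  have hedge : 2 * G.edgeSet.ncard =
      (univ.filter fun e : Fin n × Fin n => G.Adj e.1 e.2).card := by
    rw [Set.ncard_eq_toFinset_card', ← SimpleGraph.edgeFinset]
    exact SimpleGraph.two_mul_card_edgeFinset _
  have hRT : G.edgeSet.ncard ≤
      ramseyTuranNum s n (SimpleGraph.completeGraph (Fin (s + r))) x := by
    refine ncard_edgeSet_le_ramseyTuranNum (SimpleGraph.cliqueFree_iff_top_free.1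
      (by rwa [Fintype.card_fin])) ?_
    obtain ⟨U, hU, hUc⟩ := exists_card_eq_sIndepNum G (s := s) (by omega)
    rw [← hUc]
    refine lt_of_lt_of_le ?_ hx
    exact_mod_cast card_lt_of_cliqueFree_induce (fun p => by convert hfib p) hrb hU hB0
  rw [Fintype.card_fin, ← hedge] at hE
  calc n ^ 2 ≤ 4 * (K * s) ^ 2 * (2 * G.edgeSet.ncard) := hE
    _ = 8 * (K * s) ^ 2 * G.edgeSet.ncard := by ring
    _ ≤ _ := by gcongr

end RamseyTuran

end AffineColoring

namespace AffineColoring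

open RamseyTuran

/-! ### Numerical conditions and exponents -/

section Parameters

/-- With `M = 4 * q * Q * s`, the bound `1 - 1 / Q ≤ exp (-1 / Q)` gives a gain `exp (-4 * s * q ^
2)`, while each of the three other factors costs at most `exp (s * q ^ 2)`. -/
theorem rainbow_parameters {q Q s : ℕ} (hq : 4 ≤ q) (hQ : 0 < Q) (hs : 0 < s)
    (hlog : 8 * (Q : ℝ) * Real.log q ≤ q) :
    16 * Q ^ 2 * ((q ^ 2) ^ (4 * q * Q * s) * s ^ q ^ 2 * (Q - 1) ^ (4 * q * Q * s * q)) ≤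
      Q ^ (4 * q * Q * s * q) := by
  have hq' : (4 : ℝ) ≤ q := by exact_mod_cast hq
  have hQ' : (1 : ℝ) ≤ Q := by exact_mod_cast hQ
  have hs' : (1 : ℝ) ≤ s := by exact_mod_cast hs
  have hlog1 : 1 ≤ Real.log q := by
    rw [Real.le_log_iff_exp_le (by linarith)]
    linarith [Real.exp_one_lt_d9]
  have h1 : (16 * Q ^ 2 : ℝ) ≤ Real.exp (s * q ^ 2) := by
    have hQq : 8 * (Q : ℝ) ≤ q := by nlinarith
    calc (16 * Q ^ 2 : ℝ) ≤ q ^ 2 := by nlinarith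
      _ ≤ s * q ^ 2 + 1 := by nlinarith [sq_nonneg (q : ℝ)]
      _ ≤ _ := Real.add_one_le_exp _
  have h2 : (((q : ℝ) ^ 2) ^ (4 * q * Q * s)) ≤ Real.exp (s * q ^ 2) := by
    rw [← Real.exp_log (show (0 : ℝ) < ((q : ℝ) ^ 2) ^ (4 * q * Q * s) by positivity)]
    refine Real.exp_le_exp.2 ?_
    rw [Real.log_pow, Real.log_pow]
    push_cast
    calc 4 * (q : ℝ) * Q * s * (2 * Real.log q) = s * q * (8 * Q * Real.log q) := by ring
      _ ≤ s * q * q := by gcongr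
      _ = _ := by ring
  have h3 : ((s : ℝ) ^ q ^ 2) ≤ Real.exp (s * q ^ 2) := by
    calc ((s : ℝ) ^ q ^ 2) ≤ (Real.exp s) ^ q ^ 2 := by
          gcongr
          linarith [Real.add_one_le_exp (s : ℝ)]
      _ = _ := by
          rw [← Real.exp_nat_mul]
          push_cast
          ring_nf
  have h4 : ((Q : ℝ) - 1) ^ (4 * q * Q * s * q) ≤
      Q ^ (4 * q * Q * s * q) * Real.exp (-(4 * s * q ^ 2)) := by
    have h5 : ((Q : ℝ) - 1) ≤ Q * Real.exp (-(1 / Q)) := by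
      have := Real.add_one_le_exp (-(1 / (Q : ℝ)))
      calc (Q : ℝ) - 1 = Q * (-(1 / Q) + 1) := by field_simp; ring
        _ ≤ _ := by gcongr
    calc ((Q : ℝ) - 1) ^ (4 * q * Q * s * q)
        ≤ (Q * Real.exp (-(1 / Q))) ^ (4 * q * Q * s * q) :=
          pow_le_pow_left₀ (by linarith) h5 _
      _ = _ := by
          rw [mul_pow, ← Real.exp_nat_mul]
          congr 2
          push_cast
          field_simp
  have : (16 * (Q : ℝ) ^ 2 * (((q : ℝ) ^ 2) ^ (4 * q * Q * s) * (s : ℝ) ^ q ^ 2 *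
      ((Q : ℝ) - 1) ^ (4 * q * Q * s * q))) ≤ (Q : ℝ) ^ (4 * q * Q * s * q) := by
    have h0 : (0 : ℝ) ≤ ((Q : ℝ) - 1) ^ (4 * q * Q * s * q) := pow_nonneg (by linarith) _
    calc _ ≤ Real.exp (s * q ^ 2) * (Real.exp (s * q ^ 2) * Real.exp (s * q ^ 2) *
          (Q ^ (4 * q * Q * s * q) * Real.exp (-(4 * s * q ^ 2)))) := by gcongr
      _ = Q ^ (4 * q * Q * s * q) * Real.exp (-(s * q ^ 2)) := by
          have : Real.exp (-((s : ℝ) * q ^ 2)) = Real.exp (s * q ^ 2) * (Real.exp (s * q ^ 2) *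
              Real.exp (s * q ^ 2)) * Real.exp (-(4 * s * q ^ 2)) := by
            rw [← Real.exp_add, ← Real.exp_add, ← Real.exp_add]
            ring_nf
          rw [this]
          ring
      _ ≤ Q ^ (4 * q * Q * s * q) * 1 := by
          gcongr
          exact Real.exp_le_one_iff.2 (neg_nonpos.2 (by positivity))
      _ = _ := mul_one _
  have hcast : ((Q - 1 : ℕ) : ℝ) = (Q : ℝ) - 1 := by rw [Nat.cast_sub hQ, Nat.cast_one]
  rw [← hcast] at this
  exact_mod_cast this

theorem pow_le_pow_of_rpow_le {q K a b : ℕ} {τ : ℝ} (hq : 1 ≤ q) (hK : (q : ℝ) ^ τ ≤ K)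
    (hab : (a : ℝ) ≤ τ * b) : q ^ a ≤ K ^ b := by
  have hq' : (1 : ℝ) ≤ q := by exact_mod_cast hq
  have : (q : ℝ) ^ a ≤ (K : ℝ) ^ b := by
    calc (q : ℝ) ^ a = (q : ℝ) ^ (a : ℝ) := (Real.rpow_natCast _ _).symm
      _ ≤ (q : ℝ) ^ (τ * b) := Real.rpow_le_rpow_of_exponent_le hq' hab
      _ = ((q : ℝ) ^ τ) ^ b := Real.rpow_mul_natCast (by linarith) _ _
      _ ≤ _ := by gcongr
  exact_mod_cast this

theorem sq_le_mul_ramseyTuranNum {q n K s r h v : ℕ} [Fact q.Prime] [NeZero K]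
    {τ x : ℝ} (hs : 2 ≤ s) (hh : 2 ≤ h) (hbig : v ^ 2 * (h + r ^ 2) + v ≤ s + r) (hq : 4 ≤ q)
    (hqn : q ^ 2 ≤ n) (hK : (q : ℝ) ^ τ ≤ K) (hv : 2 ≤ v) (hvτ : 3 ≤ τ * (v - 1))
    (hhτ : (h + 2 * r + 4 : ℝ) ≤ τ * ((2 * r + 1) * h))
    (hlog : 8 * (K * s : ℝ) * Real.log q ≤ q) (hx : 8 * (K * s : ℝ) * s * n ≤ q * x) :
    n ^ 2 ≤ 8 * (K * s) ^ 2 *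
      ramseyTuranNum s n (SimpleGraph.completeGraph (Fin (s + r))) x := by
  have hq' : (4 : ℝ) ≤ q := by exact_mod_cast hq
  have hQ0 : 0 < K * s := Nat.mul_pos (NeZero.pos K) (by omega)
  have hQ1 : (1 : ℝ) ≤ K * s := by exact_mod_cast hQ0
  have hlog1 : 1 ≤ Real.log q := by
    rw [Real.le_log_iff_exp_le (by linarith)]
    linarith [Real.exp_one_lt_d9]
  -- The safety factor costs two powers of `q`, whence the `4` rather than `2` in `hhτ`.
  have hQq : 16 * (K * s) ^ 2 ≤ q ^ 2 := by
    have : 8 * (K * s : ℝ) ≤ q := by nlinarith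
    have : (16 * (K * s) ^ 2 : ℝ) ≤ q ^ 2 := by nlinarith
    exact_mod_cast this
  have hdiv := Nat.div_add_mod n (q ^ 2)
  have hmod := Nat.mod_lt n (show 0 < q ^ 2 by positivity)
  have hBn : q ^ 2 * (n / q ^ 2 + 1) ≤ 2 * n := by
    rw [mul_add]
    linarith [Nat.zero_le (n % q ^ 2)]
  refine sq_le_mul_ramseyTuranNum_of_nat (q := q) (h := h) (v := v) (B := n / q ^ 2 + 1)
    (M := 4 * q * (K * s) * s) (lt_of_lt_of_le (by positivity) hqn) hs hh hbig hq ?_ hBn ?_ ?_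
    (rainbow_parameters hq hQ0 (by omega) (by exact_mod_cast hlog)) ?_
  · rw [mul_add]
    omega
  · calc 16 * (K * s) ^ 2 * (q ^ 2) ^ v ≤ q ^ 2 * (q ^ 2) ^ v := by gcongr
      _ = q ^ (2 + 2 * v) := by rw [← pow_mul, ← pow_add]
      _ ≤ _ := by
        refine pow_le_pow_of_rpow_le (by omega) hK ?_
        have hv' : (2 : ℝ) ≤ v := by exact_mod_cast hv
        rw [Nat.cast_mul, Nat.cast_sub (by omega)]
        push_cast
        nlinarith
  · calc _ ≤ q ^ 2 * (q ^ 2 * (q ^ h * (q ^ 2) ^ r)) := by gcongr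
      _ = q ^ (h + 2 * r + 4) := by ring
      _ ≤ _ := by
        refine pow_le_pow_of_rpow_le (by omega) hK ?_
        push_cast
        refine hhτ.trans_eq ?_
        ring
  · have hBn' : (q : ℝ) ^ 2 * ((n / q ^ 2 + 1 : ℕ) : ℝ) ≤ 2 * n := by exact_mod_cast hBn
    refine le_of_mul_le_mul_left ?_ (show (0 : ℝ) < q by linarith)
    calc (q : ℝ) * (((4 * q * (K * s) * s : ℕ) : ℝ) * ((n / q ^ 2 + 1 : ℕ) : ℝ))
        = 4 * (K * s) * s * ((q : ℝ) ^ 2 * ((n / q ^ 2 + 1 : ℕ) : ℝ)) := by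
          push_cast
          ring
      _ ≤ 4 * (K * s) * s * (2 * n) := by gcongr
      _ = 8 * (K * s : ℝ) * s * n := by ring
      _ ≤ _ := hx

/-- Perturbation by a small `η > 0` of the critical exponents `τ = 1 / (2 * r + 1)` and `γ = (1 - δ)
/ (1 - τ)`, using continuity at `η = 0`. -/
theorem exists_exponents {r : ℕ} (hr : 1 ≤ r) {ε δ : ℝ} (hε : 0 < ε)
    (hδ : 1 / 2 + 1 / (2 * (2 * (r : ℝ) + 1)) < δ) (hδ1 : δ < 1) :
    ∃ τ γ : ℝ, 1 / (2 * (r : ℝ) + 1) < τ ∧ τ < 1 ∧ 0 < γ ∧ γ < 1 / 2 ∧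
      1 - δ < γ * (1 - τ) ∧ 2 * (γ * τ) < (1 - δ) / r + ε := by
  have hr' : (1 : ℝ) ≤ r := by exact_mod_cast hr
  have hr0 : (2 * (r : ℝ) + 1) ≠ 0 := by positivity
  have hr1 : (r : ℝ) ≠ 0 := by positivity
  set τ : ℝ → ℝ := fun η => 1 / (2 * (r : ℝ) + 1) + η with hτ
  set γ : ℝ → ℝ := fun η => (1 - δ) / (1 - τ η) + η with hγ
  have hlt : 1 / (2 * (r : ℝ) + 1) < 1 := by
    rw [div_lt_one (by positivity)]
    linarith
  have hsub : 1 - τ 0 = 2 * r / (2 * r + 1) := by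
    simp only [hτ]
    field_simp
    ring
  have hγ0 : γ 0 = (1 - δ) * (2 * r + 1) / (2 * r) := by
    simp only [hγ, hsub]
    field_simp
    ring
  have cτ : ContinuousAt τ 0 := by fun_prop
  have cγ : ContinuousAt γ 0 := by
    have : 1 - τ 0 ≠ 0 := by rw [hsub]; positivity
    fun_prop (disch := assumption)
  have e1 : ∀ᶠ η in nhds (0 : ℝ), τ η < 1 :=
    cτ.eventually_lt_const (by simpa [hτ] using hlt)
  -- At `η = 0` this is exactly the lower bound on `δ`; it is needed for `q ^ 2 ≤ n`.
  have e2 : ∀ᶠ η in nhds (0 : ℝ), γ η < 1 / 2 := by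
    refine cγ.eventually_lt_const ?_
    rw [hγ0, div_lt_iff₀ (by positivity)]
    have : 1 / 2 + 1 / (2 * (2 * (r : ℝ) + 1)) = (r + 1) / (2 * r + 1) := by
      field_simp
      ring
    rw [this, div_lt_iff₀ (by positivity)] at hδ
    linarith
  have e3 : ∀ᶠ η in nhds (0 : ℝ), 2 * (γ η * τ η) < (1 - δ) / r + ε := by
    refine (continuousAt_const.mul (cγ.mul cτ)).eventually_lt_const ?_
    have : 2 * (γ 0 * τ 0) = (1 - δ) / r := by
      rw [hγ0]
      simp only [hτ]
      field_simp
      ring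
    change 2 * (γ 0 * τ 0) < _
    rw [this]
    linarith
  obtain ⟨η, ⟨⟨h1, h2⟩, h3⟩, hη⟩ :=
    (((e1.and e2).and e3).filter_mono nhdsWithin_le_nhds |>.and
      (self_mem_nhdsWithin (s := Set.Ioi (0 : ℝ)))).exists
  have hη0 : 0 < η := hη
  have h4 : 0 < 1 - τ η := by linarith
  refine ⟨τ η, γ η, ?_, h1, ?_, h2, ?_, h3⟩
  · simp only [hτ]
    linarith
  · exact add_pos (div_pos (by linarith) h4) hη0
  · simp only [hγ]
    rw [add_mul, div_mul_cancel₀ _ h4.ne']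
    linarith [mul_pos hη0 h4]

theorem exists_prime_between_rpow {γ : ℝ} {n : ℕ} (hγ : 0 ≤ γ) (hn : 1 ≤ n) :
    ∃ q : ℕ, q.Prime ∧ (n : ℝ) ^ γ ≤ q ∧ (q : ℝ) ≤ 4 * (n : ℝ) ^ γ := by
  have h1 : 1 ≤ (n : ℝ) ^ γ := Real.one_le_rpow (by exact_mod_cast hn) hγ
  obtain ⟨q, hq, hlt, hle⟩ := Nat.exists_prime_lt_and_le_two_mul ⌈(n : ℝ) ^ γ⌉₊
    (Nat.ceil_pos.2 (by linarith)).ne'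
  have h2 : ((⌈(n : ℝ) ^ γ⌉₊ : ℕ) : ℝ) < q := by exact_mod_cast hlt
  have h3 : (q : ℝ) ≤ 2 * (⌈(n : ℝ) ^ γ⌉₊ : ℕ) := by exact_mod_cast hle
  have h4 := Nat.ceil_lt_add_one (a := (n : ℝ) ^ γ) (by linarith)
  exact ⟨q, hq, (Nat.le_ceil _).trans h2.le, by linarith⟩

theorem eventually_const_mul_rpow_le_rpow {a b : ℝ} (C : ℝ) (hab : a < b) :
    ∀ᶠ x : ℝ in Filter.atTop, C * x ^ a ≤ x ^ b := by
  filter_upwards [(tendsto_rpow_atTop (sub_pos.2 hab)).eventually_ge_atTop C,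
    Filter.eventually_gt_atTop 0] with x hx hx0
  calc C * x ^ a ≤ x ^ (b - a) * x ^ a := by gcongr
    _ = x ^ b := by rw [← Real.rpow_add hx0, sub_add_cancel]

theorem eventually_const_mul_rpow_mul_log_le {a : ℝ} (C : ℝ) (ha : a < 1) :
    ∀ᶠ x : ℝ in Filter.atTop, C * x ^ a * Real.log x ≤ x := by
  have h := (isLittleO_log_rpow_atTop (sub_pos.2 ha)).bound
    (show (0 : ℝ) < 1 / (|C| + 1) by positivity)
  filter_upwards [h, Filter.eventually_ge_atTop 1] with x hx hx1
  have hx0 : 0 < x := by linarith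
  have hlog : 0 ≤ Real.log x := Real.log_nonneg hx1
  rw [Real.norm_of_nonneg hlog, Real.norm_of_nonneg (by positivity), div_mul_eq_mul_div,
    one_mul, le_div_iff₀ (by positivity)] at hx
  calc C * x ^ a * Real.log x ≤ (|C| + 1) * x ^ a * Real.log x := by
        gcongr
        linarith [le_abs_self C]
    _ = x ^ a * (Real.log x * (|C| + 1)) := by ring
    _ ≤ x ^ a * x ^ (1 - a) := by gcongr
    _ = x := by rw [← Real.rpow_add hx0, add_sub_cancel, Real.rpow_one]

end Parameters

end AffineColoring

/-! ### Choice of parameters and conclusion -/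

theorem theorem4p3 (r : ℕ) (hr : 1 ≤ r) (ε : ℝ) (hε : 0 < ε) (δ : ℝ)
    (hδ : 1 / 2 + 1 / (2 * (2 * (r : ℝ) + 1)) < δ) (hδ1 : δ < 1) :
    ∃ s₀ : ℕ, ∀ s : ℕ, s₀ ≤ s →
      ∃ c : ℝ, 0 < c ∧ ∃ n₀ : ℕ, ∀ n : ℕ, n₀ ≤ n →
        c * (n : ℝ) ^ (2 - (1 - δ) / (r : ℝ) - ε) ≤
          (RamseyTuran.ramseyTuranNum s n (SimpleGraph.completeGraph (Fin (s + r))) ((n : ℝ) ^ δ) : ℝ) := by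
  obtain ⟨τ, γ, hτ0, hτ1, hγ0, hγ1, hγτ, hexp⟩ :=
    AffineColoring.exists_exponents hr hε hδ hδ1
  have hτpos : 0 < τ := lt_trans (by positivity) hτ0
  have hτr : 0 < τ * (2 * r + 1) - 1 := by
    rw [div_lt_iff₀ (by positivity)] at hτ0
    linarith
  obtain ⟨h', hh'⟩ := exists_nat_ge ((2 * r + 4 : ℝ) / (τ * (2 * r + 1) - 1))
  rw [div_le_iff₀ hτr] at hh'
  obtain ⟨h, hh2, hhh⟩ : ∃ h : ℕ, 2 ≤ h ∧ h' ≤ h := ⟨h' + 2, by omega, by omega⟩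
  have hh : (h + 2 * r + 4 : ℝ) ≤ τ * ((2 * r + 1) * h) := by
    have : (h' : ℝ) ≤ h := by exact_mod_cast hhh
    have := mul_le_mul_of_nonneg_right this hτr.le
    linarith
  -- Then `v - 1 = 3 * (2 * r + 1)`, so `τ * (v - 1) ≥ 3`.
  set v := 6 * r + 4 with hv
  refine ⟨v ^ 2 * (h + r ^ 2) + v, fun s hs => ?_⟩
  have hs2 : 2 ≤ s := by
    have := Nat.zero_le (v ^ 2 * (h + r ^ 2))
    omega
  have hs0 : (0 : ℝ) < s := by exact_mod_cast (by omega : 0 < s)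
  -- The `2` is from rounding up in `K`, the `4` from `q ≤ 4 * n ^ γ`; together `K * s ≤ 2 * s * 4 *
  -- n ^ (γ * τ)`.
  set C : ℝ := 8 * (2 * s * 4) ^ 2 with hC
  have hC0 : 0 < C := by positivity
  refine ⟨1 / C, by positivity, ?_⟩
  have hγlim := (tendsto_rpow_atTop hγ0).comp (tendsto_natCast_atTop_atTop (R := ℝ))
  obtain ⟨q₀, hq₀⟩ := Filter.eventually_atTop.1
    (AffineColoring.eventually_const_mul_rpow_mul_log_le (16 * s : ℝ) hτ1)
  have E := (((hγlim.eventually_ge_atTop (max q₀ 4)).and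
    (tendsto_natCast_atTop_atTop.eventually (AffineColoring.eventually_const_mul_rpow_le_rpow
      16 (show 2 * γ < 1 by linarith)))).and
    (tendsto_natCast_atTop_atTop.eventually (AffineColoring.eventually_const_mul_rpow_le_rpow
      (16 * s ^ 2 : ℝ) hγτ))).and (Filter.eventually_ge_atTop 1)
  obtain ⟨n₀, hn₀⟩ := Filter.eventually_atTop.1 E
  refine ⟨n₀, fun n hn => ?_⟩
  obtain ⟨⟨⟨hnq, hnγ⟩, hnδ⟩, hn1⟩ := hn₀ n hn
  have hn1' : (1 : ℝ) ≤ n := by exact_mod_cast hn1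
  have hn0 : (0 : ℝ) < n := by linarith
  obtain ⟨q, hqp, hqlo, hqhi⟩ := AffineColoring.exists_prime_between_rpow hγ0.le hn1
  have : Fact q.Prime := ⟨hqp⟩
  have hqmax : max q₀ 4 ≤ (q : ℝ) := le_trans hnq hqlo
  have hq4 : (4 : ℝ) ≤ q := (le_max_right _ _).trans hqmax
  have hq0 : (0 : ℝ) < q := by linarith
  have hqτ1 : 1 ≤ (q : ℝ) ^ τ := Real.one_le_rpow (by linarith) hτpos.le
  set K := ⌈(q : ℝ) ^ τ⌉₊ with hK
  have hKlo : (q : ℝ) ^ τ ≤ K := Nat.le_ceil _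
  have hKhi : (K : ℝ) ≤ 2 * (q : ℝ) ^ τ := by
    have := Nat.ceil_lt_add_one (a := (q : ℝ) ^ τ) (by linarith)
    linarith
  have : NeZero K := ⟨(Nat.ceil_pos.2 (by linarith)).ne'⟩
  have key := AffineColoring.sq_le_mul_ramseyTuranNum (q := q) (n := n) (K := K) (s := s)
    (r := r) (h := h) (v := v) (τ := τ) (x := (n : ℝ) ^ δ) hs2 hh2 (by omega)
    (by exact_mod_cast hq4) ?_ hKlo (by omega) ?_ hh ?_ ?_
  · have hKs : (K * s : ℝ) ≤ 2 * s * 4 * (n : ℝ) ^ (γ * τ) := by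
      have h1 : (q : ℝ) ^ τ ≤ 4 * (n : ℝ) ^ (γ * τ) := by
        calc (q : ℝ) ^ τ ≤ (4 * (n : ℝ) ^ γ) ^ τ := by gcongr
          _ = 4 ^ τ * (n : ℝ) ^ (γ * τ) := by
            rw [Real.mul_rpow (by norm_num) (by positivity), ← Real.rpow_mul hn0.le]
          _ ≤ 4 ^ (1 : ℝ) * (n : ℝ) ^ (γ * τ) := by
            gcongr
            norm_num
          _ = _ := by rw [Real.rpow_one]
      calc (K * s : ℝ) ≤ 2 * (4 * (n : ℝ) ^ (γ * τ)) * s := by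
            gcongr
            linarith
        _ = _ := by ring
    set R := RamseyTuran.ramseyTuranNum s n (SimpleGraph.completeGraph (Fin (s + r)))
      ((n : ℝ) ^ δ) with hR
    have key' : (n : ℝ) ^ 2 ≤ 8 * (K * s : ℝ) ^ 2 * R := by exact_mod_cast key
    have hsplit : (n : ℝ) ^ (2 - (1 - δ) / (r : ℝ) - ε) * (n : ℝ) ^ (2 * (γ * τ)) ≤
        (n : ℝ) ^ 2 := by
      rw [← Real.rpow_add hn0, ← Real.rpow_two]
      exact Real.rpow_le_rpow_of_exponent_le hn1' (by linarith)
    have hsq : (n : ℝ) ^ (2 * (γ * τ)) = ((n : ℝ) ^ (γ * τ)) ^ 2 := by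
      rw [mul_comm 2, Real.rpow_mul hn0.le, Real.rpow_two]
    rw [div_mul_eq_mul_div, one_mul, div_le_iff₀ hC0]
    refine le_of_mul_le_mul_right ?_ (show 0 < (n : ℝ) ^ (2 * (γ * τ)) by positivity)
    calc _ ≤ (n : ℝ) ^ 2 := hsplit
      _ ≤ 8 * (K * s : ℝ) ^ 2 * R := key'
      _ ≤ 8 * (2 * s * 4 * (n : ℝ) ^ (γ * τ)) ^ 2 * R := by gcongr
      _ = _ := by
        rw [hsq, hC]
        ring
  · have : (q : ℝ) ^ 2 ≤ n := by
      calc (q : ℝ) ^ 2 ≤ (4 * (n : ℝ) ^ γ) ^ 2 := by gcongr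
        _ = 16 * (n : ℝ) ^ (2 * γ) := by
          rw [mul_pow, mul_comm 2 γ, Real.rpow_mul hn0.le, Real.rpow_two]
          norm_num
        _ ≤ (n : ℝ) ^ (1 : ℝ) := hnγ
        _ = n := Real.rpow_one _
    exact_mod_cast this
  · rw [hv]
    push_cast
    linarith
  · calc 8 * (K * s : ℝ) * Real.log q ≤ 8 * (2 * (q : ℝ) ^ τ * s) * Real.log q := by
          have : 0 ≤ Real.log q := Real.log_nonneg (by linarith)
          gcongr
      _ = 16 * s * (q : ℝ) ^ τ * Real.log q := by ring
      _ ≤ q := hq₀ q ((le_max_left _ _).trans hqmax)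
  · have h1 : (16 * s ^ 2 : ℝ) * (n : ℝ) ^ (1 - δ) ≤ (q : ℝ) ^ (1 - τ) := by
      refine hnδ.trans ?_
      rw [Real.rpow_mul hn0.le]
      exact Real.rpow_le_rpow (by positivity) hqlo (by linarith)
    calc 8 * (K * s : ℝ) * s * n ≤ 8 * (2 * (q : ℝ) ^ τ * s) * s * n := by gcongr
      _ = (q : ℝ) ^ τ * (16 * s ^ 2 * (n : ℝ) ^ (1 - δ)) * (n : ℝ) ^ δ := by
        have : (n : ℝ) = (n : ℝ) ^ (1 - δ) * (n : ℝ) ^ δ := by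
          rw [← Real.rpow_add hn0, sub_add_cancel, Real.rpow_one]
        nth_rewrite 1 [this]
        ring
      _ ≤ (q : ℝ) ^ τ * (q : ℝ) ^ (1 - τ) * (n : ℝ) ^ δ := by gcongr
      _ = q * (n : ℝ) ^ δ := by
        rw [← Real.rpow_add hq0, add_sub_cancel, Real.rpow_one]
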